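/- All vector lattices are over $\mathbb{R}$, and $\mathbb{N}=\{1,2,3,\ldots\}$. For $n\in\mathbb{N}$ let $H_n$ be the vector lattice, with pointwise operations and order, of continuous functions $f\colon\mathbb{R}^n\to\mathbb{R}$ that are positively homogeneous, that is, $f(\lambda t)=\lambda f(t)$ for all $\lambda\in[0,\infty)$ and $t\in\mathbb{R}^n$. Let $\pi_i^{(n)}\in H_n$ be the $i$-th coordinate projection. A vector lattice $X$ is Archimedean if, whenever $x,y\in X^+$ satisfy $kx\le y$ for each $k\in\mathbb{N}$, it follows that $x=0$. A vector lattice $X$ admits a positively homogeneous continuous function calculus if, for each $n\in\mathbb{N}$ and each $x=(x_1,\ldots,x_n)\in X^n$, there is a vector lattice homomorphism (a linear map preserving $\vee$ and $\wedge$) $\Phi_x\colon H_n\to X$ such that $$\Phi_x(\pi_i^{(n)})=x_i\qquad(i\in\{1,\ldots,n\}).\qquad(1)$$ Any such family $x\mapsto\Phi_x$ is called a positively homogeneous continuous function calculus for $X$. For a positive element $e$ of an Archimedean vector lattice $X$, let $I_e=\{x\in X: |x|\le\lambda e\text{ for some }\lambda\in[0,\infty)\}$, equipped with the norm $\|x\|_e=\inf\{\lambda\in[0,\infty):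 |x|\le\lambda e\}$. We say that $X$ is finitely uniformly complete if, for each $n\in\mathbb{N}$ and $x_1,\ldots,x_n\in X$, there is a positive element $e\in X$ such that $e\ge|x_1|\vee\cdots\vee|x_n|$ and the norm $\|\cdot\|_e$ is complete on the closed (vector) sublattice of $(I_e,\|\cdot\|_e)$ generated by $x_1,\ldots,x_n$. **Theorem.** Let $X$ be an Archimedean vector lattice. Then $X$ admits a positively homogeneous continuous function calculus if and only if $X$ is finitely uniformly complete. When $X$ is finitely uniformly complete, the positively homogeneous continuous function calculus is unique, in the sense that for each $n\in\mathbb{N}$ and $x\in X^n$ there is only one vector lattice homomorphism $\Phi_x\colon H_n\to X$ which satisfies (1), and $$\Phi_{(\Phi_x(f_1),\ldots,\Phi_x(f_m))}(g)=\Phi_x\bigl(g\circ(f_1\times\cdots\times f_m)\bigr)$$ for each $m,n\in\mathbb{N}$, $x\in X^n$, $f_1,\ldots,f_m\in H_n$ and $g\in H_m$, where $f_1\times\cdots\times f_m\colon\mathbb{R}^n\to\mathbb{R}^m$ is defined by $(f_1\times\cdots\times f_m)(t)=(f_1(t),\ldots,f_m(t))$ for $t\in\mathbb{R}^n$. -/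

import Mathlib

/-! Vector lattices (Riesz spaces) over `ℝ` are described by Mathlib's classes
`[AddCommGroup X] [Lattice X] [IsOrderedAddMonoid X] [Module ℝ X] [IsOrderedModule ℝ X]`. -/

set_option linter.unusedSectionVars false

namespace VectorLattice

/-- A vector lattice is Archimedean if `n x ≤ y` for all `n`, with `x, y ≥ 0`, forces `x = 0`.
(Mathlib's class `Archimedean` is a different notion.) -/
def IsArchimedean (X : Type*) [AddCommGroup X] [Lattice X] : Prop :=
  ∀ x y : X, 0 ≤ x → 0 ≤ y → (∀ n : ℕ, n • x ≤ y) → x = 0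

/-- A vector lattice homomorphism: a linear map that preserves `⊔` and `⊓`. -/
structure IsLatticeHom {E F : Type*} [AddCommGroup E] [Lattice E] [Module ℝ E]
    [AddCommGroup F] [Lattice F] [Module ℝ F] (T : E →ₗ[ℝ] F) : Prop where
  map_sup : ∀ a b : E, T (a ⊔ b) = T a ⊔ T b
  map_inf : ∀ a b : E, T (a ⊓ b) = T a ⊓ T b

/-! ### The vector lattice of positively homogeneous continuous functions on `ℝⁿ` -/

/-- The space of positively homogeneous, continuous, real-valued functions on `ℝⁿ`. -/
def H (n : ℕ) : Submodule ℝ C(Fin n → ℝ, ℝ) where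
  carrier := {f | ∀ c : ℝ, 0 ≤ c → ∀ t : Fin n → ℝ, f (c • t) = c * f t}
  add_mem' := by
    intro f g hf hg c hc t
    simp only [ContinuousMap.add_apply, hf c hc t, hg c hc t, mul_add]
  zero_mem' := by
    intro c _ t
    simp
  smul_mem' := by
    intro a f hf c hc t
    simp only [ContinuousMap.smul_apply, hf c hc t, smul_eq_mul]
    ring

theorem H_sup_mem {n : ℕ} ⦃f g : C(Fin n → ℝ, ℝ)⦄ (hf : f ∈ H n) (hg : g ∈ H n) :
    f ⊔ g ∈ H n := by
  intro c hc t
  simp only [ContinuousMap.sup_apply, hf c hc t, hg c hc t]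
  exact (mul_max_of_nonneg _ _ hc).symm

theorem H_inf_mem {n : ℕ} ⦃f g : C(Fin n → ℝ, ℝ)⦄ (hf : f ∈ H n) (hg : g ∈ H n) :
    f ⊓ g ∈ H n := by
  intro c hc t
  simp only [ContinuousMap.inf_apply, hf c hc t, hg c hc t]
  exact (mul_min_of_nonneg _ _ hc).symm

/-- The pointwise lattice structure on `H n`. -/
instance instLatticeH (n : ℕ) : Lattice (H n) :=
  Subtype.lattice (P := fun f => f ∈ H n) H_sup_mem H_inf_mem

/-- The coordinate projection `(t₁, …, tₙ) ↦ tᵢ` as an element of `H n`. -/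
def proj {n : ℕ} (i : Fin n) : H n :=
  ⟨⟨fun t => t i, continuous_apply i⟩, fun _ _ _ => rfl⟩

/-- The composition `g ∘ (f₁ × ⋯ × fₘ)`, that is, `t ↦ g (f₁ t, …, fₘ t)`. -/
def comp {m n : ℕ} (g : H m) (f : Fin m → H n) : H n :=
  ⟨(g : C(Fin m → ℝ, ℝ)).comp (ContinuousMap.pi fun i => (f i : C(Fin n → ℝ, ℝ))), by
    intro c hc t
    have h : (fun i => (f i : C(Fin n → ℝ, ℝ)) (c • t))
        = c • fun i => (f i : C(Fin n → ℝ, ℝ)) t := by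
      funext i
      exact (f i).2 c hc t
    change (g : C(Fin m → ℝ, ℝ)) (fun i => (f i : C(Fin n → ℝ, ℝ)) (c • t))
      = c * (g : C(Fin m → ℝ, ℝ)) (fun i => (f i : C(Fin n → ℝ, ℝ)) t)
    rw [h]
    exact g.2 c hc _⟩

/-! ### Function calculus -/

section Calculus

variable {X : Type*} [AddCommGroup X] [Lattice X] [Module ℝ X]

/-- `Φ : H n → X` is a vector lattice homomorphism that sends the `i`-th coordinate projection
to `x i` for each `i`. -/
structure IsCalculusAt {n : ℕ} (x : Fin n → X) (Φ : H n →ₗ[ℝ] X) : Prop where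
  isLatticeHom : IsLatticeHom Φ
  map_proj : ∀ i, Φ (proj i) = x i

/-- The family `x ↦ Φ_x` is a positively homogeneous continuous function calculus for `X`. -/
def IsCalculus (Φ : (n : ℕ) → (Fin n → X) → (H n →ₗ[ℝ] X)) : Prop :=
  ∀ (n : ℕ) (x : Fin n → X), IsCalculusAt x (Φ n x)

variable (X) in
/-- `X` admits a positively homogeneous continuous function calculus. -/
def AdmitsCalculus : Prop :=
  ∀ (n : ℕ) (x : Fin n → X), ∃ Φ : H n →ₗ[ℝ] X, IsCalculusAt x Φ

end Calculus

/-! ### Order ideals, their norms, and finite uniform completeness -/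

/-- The intersection of all closed vector sublattices (linear subspaces that are closed under
`⊔` and `⊓` and topologically closed) that contain the set `S`. -/
def closedSublattice {E : Type*} [AddCommGroup E] [Lattice E] [Module ℝ E] [TopologicalSpace E]
    (S : Set E) : Submodule ℝ E :=
  sInf {Y : Submodule ℝ E | SupClosed (Y : Set E) ∧ InfClosed (Y : Set E) ∧
    IsClosed (Y : Set E) ∧ S ⊆ Y}

section Ideal

variable {X : Type*} [AddCommGroup X] [Lattice X] [IsOrderedAddMonoid X] [Module ℝ X]
  [IsOrderedModule ℝ X]

theorem abs_smul_le_smul (a : ℝ) (x : X) : |a • x| ≤ |a| • |x| := by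
  have key : ∀ (b : ℝ) (y : X), b • y ≤ |b| • |y| := by
    intro b y
    rcases le_total 0 b with hb | hb
    · rw [abs_of_nonneg hb]
      exact smul_le_smul_of_nonneg_left (le_abs_self y) hb
    · rw [abs_of_nonpos hb, ← neg_smul_neg]
      exact smul_le_smul_of_nonneg_left (neg_le_abs y) (neg_nonneg.2 hb)
  refine abs_le'.2 ⟨key a x, ?_⟩
  have h := key a (-x)
  rwa [smul_neg, abs_neg] at h

/-- The order ideal `I_e = {x | |x| ≤ c e for some c ∈ [0, ∞)}` generated by `e`. -/
def orderIdeal (e : X) : Submodule ℝ X where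
  carrier := {x | ∃ c : ℝ, 0 ≤ c ∧ |x| ≤ c • e}
  add_mem' := by
    rintro x y ⟨c, hc, hx⟩ ⟨d, hd, hy⟩
    refine ⟨c + d, add_nonneg hc hd, ?_⟩
    rw [add_smul]
    exact (abs_add_le x y).trans (add_le_add hx hy)
  zero_mem' := ⟨0, le_rfl, by simp⟩
  smul_mem' := by
    rintro a x ⟨c, hc, hx⟩
    refine ⟨|a| * c, mul_nonneg (abs_nonneg a) hc, ?_⟩
    rw [mul_smul]
    exact (abs_smul_le_smul a x).trans (smul_le_smul_of_nonneg_left hx (abs_nonneg a))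

theorem orderIdeal_sup_mem {e : X} ⦃x y : X⦄ (hx : x ∈ orderIdeal e) (hy : y ∈ orderIdeal e) :
    x ⊔ y ∈ orderIdeal e := by
  obtain ⟨c, hc, hx⟩ := hx
  obtain ⟨d, hd, hy⟩ := hy
  refine ⟨c + d, add_nonneg hc hd, ?_⟩
  rw [add_smul]
  have h0x : (0 : X) ≤ c • e := (abs_nonneg x).trans hx
  have h0y : (0 : X) ≤ d • e := (abs_nonneg y).trans hy
  refine abs_le'.2 ⟨sup_le ?_ ?_, ?_⟩
  · exact ((le_abs_self x).trans hx).trans (le_add_of_nonneg_right h0y)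
  · exact ((le_abs_self y).trans hy).trans (le_add_of_nonneg_left h0x)
  · exact ((neg_le_neg le_sup_left).trans ((neg_le_abs x).trans hx)).trans
      (le_add_of_nonneg_right h0y)

theorem orderIdeal_inf_mem {e : X} ⦃x y : X⦄ (hx : x ∈ orderIdeal e) (hy : y ∈ orderIdeal e) :
    x ⊓ y ∈ orderIdeal e := by
  have h := (orderIdeal e).neg_mem
    (orderIdeal_sup_mem ((orderIdeal e).neg_mem hx) ((orderIdeal e).neg_mem hy))
  rwa [neg_sup, neg_neg, neg_neg] at h

/-- The lattice structure on `I_e` inherited from `X`. -/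
instance instLatticeOrderIdeal (e : X) : Lattice (orderIdeal e) :=
  Subtype.lattice (P := fun x => x ∈ orderIdeal e) orderIdeal_sup_mem orderIdeal_inf_mem

/-- `‖x‖_e = inf {c ∈ [0, ∞) | |x| ≤ c e}`. -/
noncomputable def orderNorm (e x : X) : ℝ :=
  sInf {c : ℝ | 0 ≤ c ∧ |x| ≤ c • e}

theorem orderNorm_le {e x : X} {c : ℝ} (hc : 0 ≤ c) (h : |x| ≤ c • e) : orderNorm e x ≤ c :=
  csInf_le ⟨0, fun _ hd => hd.1⟩ ⟨hc, h⟩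

/-- The group seminorm `‖·‖_e` on `I_e`; it is a norm when `X` is Archimedean. -/
noncomputable def orderSeminorm (e : X) : AddGroupSeminorm (orderIdeal e) where
  toFun x := orderNorm e (x : X)
  map_zero' := le_antisymm (orderNorm_le le_rfl (by simp)) (Real.sInf_nonneg fun _ hd => hd.1)
  add_le' := by
    rintro ⟨x, hx⟩ ⟨y, hy⟩
    refine le_of_forall_pos_le_add fun ε hε => ?_
    obtain ⟨c, ⟨hc, hcx⟩, hc'⟩ := exists_lt_of_csInf_lt hx
      (lt_add_of_pos_right (orderNorm e x) (half_pos hε))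
    obtain ⟨d, ⟨hd, hdy⟩, hd'⟩ := exists_lt_of_csInf_lt hy
      (lt_add_of_pos_right (orderNorm e y) (half_pos hε))
    have h : orderNorm e (x + y) ≤ c + d := by
      refine orderNorm_le (add_nonneg hc hd) ?_
      rw [add_smul]
      exact (abs_add_le x y).trans (add_le_add hcx hdy)
    change orderNorm e (x + y) ≤ orderNorm e x + orderNorm e y + ε
    linarith
  neg' := by
    rintro ⟨x, hx⟩
    change sInf {c : ℝ | 0 ≤ c ∧ |-x| ≤ c • e} = sInf {c : ℝ | 0 ≤ c ∧ |x| ≤ c • e}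
    rw [abs_neg]

/-- `I_e` carries the metric, topology and uniform structure of `‖·‖_e`. -/
noncomputable instance instSeminormedOrderIdeal (e : X) : SeminormedAddCommGroup (orderIdeal e) :=
  (orderSeminorm e).toSeminormedAddCommGroup

variable (X) in
/-- Finite uniform completeness: for all `x₁, …, xₙ` there is a positive `e` that dominates
`|x₁| ∨ ⋯ ∨ |xₙ|` such that `‖·‖_e` is complete on the closed sublattice of `(I_e, ‖·‖_e)`
generated by `x₁, …, xₙ`. -/
def FinitelyUniformlyComplete : Prop :=
  ∀ (n : ℕ) (x : Fin n → X), ∃ e : X, 0 ≤ e ∧ (∀ i, |x i| ≤ e) ∧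
    IsComplete (closedSublattice ((fun y : orderIdeal e => (y : X)) ⁻¹' Set.range x) :
      Set (orderIdeal e))

end Ideal

end VectorLattice

/-!
The function calculus is built from the real lattice homomorphisms on order ideals. Let `e ≥ 0`
dominate `|x₁|, …, |xₙ|`, and let `A` be the set of lattice homomorphisms `φ : I_e → ℝ` with
`φ e = 1`. Since `X` is Archimedean, `A` determines the order of `I_e`: if `φ y ≤ c` for all
`φ ∈ A`, then `y ≤ c e` (`le_smul_of_forall_isLatticeHom`). This follows from a Hahn--Banach
argument: the gauge `y ↦ inf {c | y ≤ c e}` is sublinear and preserves suprema, the usual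
Hahn--Banach step keeps both properties, and a functional that is minimal among those with both
properties is a lattice homomorphism.

Hence for `f ∈ H n` there is at most one `y ∈ I_e` with `φ y = f (φ x₁, …, φ xₙ)` for all `φ ∈ A`,
and setting `Φ f = y` gives a lattice homomorphism as soon as `y` always exists. The set of `f` for
which `y` exists in the closed sublattice `L` generated by the `xᵢ` is a vector sublattice that
contains the coordinate projections, so it is uniformly dense by Stone--Weierstrass
(`exists_abs_sub_le_smul_sumAbs`). Completeness of `L` passes existence to uniform limits
(`exists_isCalculusAt`).

Conversely, a calculus `Φ` at `x` maps `H n` into `I_e` with `e = Φ (|t₁| + ⋯ + |tₙ|)`. By truncation,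
elements of the range lift to `H n` without increase of norm, so uniform completeness of `H n` makes
the range complete. The range then contains the closed sublattice generated by the `xᵢ`
(`IsCalculusAt.exists_isComplete_closedSublattice`).

Uniqueness is Stone--Weierstrass again, applied to the sublattice on which two calculi agree, and
the composition formula is an instance of uniqueness.
-/

open Filter Topology

namespace VectorLattice

/-! ### Lattice homomorphisms -/

namespace IsLatticeHom

variable {E F : Type*} [AddCommGroup E] [Lattice E] [Module ℝ E]
  [AddCommGroup F] [Lattice F] [Module ℝ F] {T : E →ₗ[ℝ] F}

theorem monotone (hT : IsLatticeHom T) {a b : E} (h : a ≤ b) : T a ≤ T b := by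
  rw [← sup_eq_right, ← hT.map_sup, sup_eq_right.2 h]

theorem map_abs (hT : IsLatticeHom T) (a : E) : T |a| = |T a| := by
  rw [abs, abs, hT.map_sup, map_neg]

end IsLatticeHom

section Sublinear

variable {E : Type*} [AddCommGroup E] [Lattice E] [IsOrderedAddMonoid E] [Module ℝ E]
  [IsOrderedModule ℝ E]

/-! ### Sublinear functionals that preserve suprema -/

/-- A monotone sublinear functional with `p (x ⊔ y) = max (p x) (p y)`. Homogeneity and the
formula for suprema are recorded as inequalities: the reverse inequalities follow. -/
structure IsSupSublinear (p : E → ℝ) : Prop where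
  mono : Monotone p
  add_le : ∀ x y, p (x + y) ≤ p x + p y
  smul_le : ∀ c : ℝ, 0 < c → ∀ x, p (c • x) ≤ c * p x
  sup_le : ∀ x y, p (x ⊔ y) ≤ max (p x) (p y)

namespace IsSupSublinear

variable {p : E → ℝ}

theorem map_smul (hp : IsSupSublinear p) {c : ℝ} (hc : 0 < c) (x : E) :
    p (c • x) = c * p x := by
  refine le_antisymm (hp.smul_le c hc x) ?_
  have h := hp.smul_le c⁻¹ (inv_pos.2 hc) (c • x)
  rw [smul_smul, inv_mul_cancel₀ hc.ne', one_smul] at h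
  calc c * p x ≤ c * (c⁻¹ * p (c • x)) := mul_le_mul_of_nonneg_left h hc.le
    _ = p (c • x) := by field_simp

theorem map_zero (hp : IsSupSublinear p) : p 0 = 0 := by
  have h := hp.map_smul (zero_lt_two) 0
  rw [smul_zero] at h
  linarith

theorem neg_le (hp : IsSupSublinear p) (x : E) : -p (-x) ≤ p x := by
  have h := hp.add_le x (-x)
  rw [add_neg_cancel, hp.map_zero] at h
  linarith

/-- The pointwise infimum of a family of monotone functionals is sublinear and preserves suprema
as soon as the family satisfies the inequalities up to a change of index. This covers chains of
such functionals as well as the one-parameter families in the proof of Hahn--Banach. -/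
theorem iInf {ι : Type*} [Nonempty ι] {P : ι → E → ℝ}
    (hbdd : ∀ x, BddBelow (Set.range fun i => P i x))
    (hmono : ∀ i, Monotone (P i))
    (hadd : ∀ i j x y, ∃ k, P k (x + y) ≤ P i x + P j y)
    (hsmul : ∀ i (c : ℝ), 0 < c → ∀ x, ∃ k, P k (c • x) ≤ c * P i x)
    (hsup : ∀ i j x y, ∃ k, P k (x ⊔ y) ≤ max (P i x) (P j y)) :
    IsSupSublinear fun x => ⨅ i, P i x where
  mono x y h := ciInf_mono (hbdd x) fun i => hmono i h
  add_le x y := by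
    refine le_ciInf_add_ciInf fun i j => ?_
    obtain ⟨k, hk⟩ := hadd i j x y
    exact (ciInf_le (hbdd _) k).trans hk
  smul_le c hc x := by
    rw [Real.mul_iInf_of_nonneg hc.le]
    refine le_ciInf fun i => ?_
    obtain ⟨k, hk⟩ := hsmul i c hc x
    exact (ciInf_le (hbdd _) k).trans hk
  sup_le x y := by
    refine le_of_forall_pos_le_add fun ε hε => ?_
    obtain ⟨i, hi⟩ := exists_lt_of_ciInf_lt (lt_add_of_pos_right (⨅ i, P i x) hε)
    obtain ⟨j, hj⟩ := exists_lt_of_ciInf_lt (lt_add_of_pos_right (⨅ i, P i y) hε)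
    obtain ⟨k, hk⟩ := hsup i j x y
    refine (ciInf_le (hbdd _) k).trans (hk.trans ?_)
    rw [max_add]
    exact max_le_max hi.le hj.le

/-- The Hahn--Banach step. Since `t ↦ p (x + t • z) - t * p z` is decreasing, the infimum over `t`
still preserves suprema. -/
theorem exists_le_neg (hp : IsSupSublinear p) (z : E) :
    ∃ p' : E → ℝ, IsSupSublinear p' ∧ p' ≤ p ∧ p' (-z) ≤ -p z := by
  -- A single `P t` is not sublinear: adding arguments adds the parameters.
  let P : {t : ℝ // 0 < t} → E → ℝ := fun t x => p (x + (t : ℝ) • z) - t * p z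
  have : Nonempty {t : ℝ // 0 < t} := ⟨⟨1, one_pos⟩⟩
  have hbdd : ∀ x, BddBelow (Set.range fun i => P i x) := by
    intro x
    refine ⟨-p (-x), ?_⟩
    rintro _ ⟨t, rfl⟩
    have h := hp.add_le (x + (t : ℝ) • z) (-x)
    rw [add_neg_cancel_comm, hp.map_smul t.2] at h
    change -p (-x) ≤ p (x + (t : ℝ) • z) - t * p z
    linarith
  have hanti : ∀ (s t : {t : ℝ // 0 < t}), (s : ℝ) ≤ t → ∀ x, P t x ≤ P s x := by
    intro s t hst x
    rcases hst.eq_or_lt with h | h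
    · rw [Subtype.ext h]
    · have h1 := hp.add_le (x + (s : ℝ) • z) (((t : ℝ) - s) • z)
      rw [hp.map_smul (sub_pos.2 h), add_assoc, ← add_smul, add_sub_cancel] at h1
      change p (x + (t : ℝ) • z) - t * p z ≤ p (x + (s : ℝ) • z) - s * p z
      linarith
  have hmono : ∀ t, Monotone (P t) := fun t x y h =>
    sub_le_sub_right (hp.mono (add_le_add_left h _)) _
  refine ⟨fun x => ⨅ t, P t x, iInf hbdd hmono ?_ ?_ ?_, ?_, ?_⟩
  · intro s t x y
    refine ⟨⟨s + t, add_pos s.2 t.2⟩, ?_⟩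
    have h := hp.add_le (x + (s : ℝ) • z) (y + (t : ℝ) • z)
    rw [add_add_add_comm, ← add_smul] at h
    change p (x + y + ((s : ℝ) + t) • z) - (s + t) * p z
      ≤ (p (x + (s : ℝ) • z) - s * p z) + (p (y + (t : ℝ) • z) - t * p z)
    linarith
  · intro t c hc x
    refine ⟨⟨c * t, mul_pos hc t.2⟩, ?_⟩
    change p (c • x + (c * (t : ℝ)) • z) - c * t * p z ≤ c * (p (x + (t : ℝ) • z) - t * p z)
    rw [mul_smul, ← smul_add, hp.map_smul hc]
    linarith
  · intro s t x y
    let r : {t : ℝ // 0 < t} := ⟨max s t, lt_max_of_lt_left s.2⟩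
    refine ⟨r, ?_⟩
    have h : P r (x ⊔ y) ≤ max (P r x) (P r y) := by
      change p (x ⊔ y + (r : ℝ) • z) - r * p z ≤ max (p (x + (r : ℝ) • z) - r * p z)
        (p (y + (r : ℝ) • z) - r * p z)
      rw [sup_add, max_sub_sub_right]
      exact sub_le_sub_right (hp.sup_le _ _) _
    exact h.trans (max_le_max (hanti s r (le_max_left _ _) x) (hanti t r (le_max_right _ _) y))
  · intro x
    refine (ciInf_le (hbdd x) ⟨1, one_pos⟩).trans ?_
    have h := hp.add_le x ((1 : ℝ) • z)
    rw [hp.map_smul one_pos] at h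
    change p (x + (1 : ℝ) • z) - 1 * p z ≤ p x
    linarith
  · refine (ciInf_le (hbdd _) ⟨1, one_pos⟩).trans (le_of_eq ?_)
    change p (-z + (1 : ℝ) • z) - 1 * p z = -p z
    rw [one_smul, neg_add_cancel, hp.map_zero, one_mul, zero_sub]

/-- A minimal functional below `p`, by Zorn's lemma. -/
theorem exists_minimal (hp : IsSupSublinear p) :
    ∃ m : E → ℝ, IsSupSublinear m ∧ m ≤ p ∧ ∀ q, IsSupSublinear q → q ≤ m → m ≤ q := by
  suffices hchains : ∀ c ⊆ {q : (E → ℝ)ᵒᵈ | IsSupSublinear (OrderDual.ofDual q)},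
      IsChain (· ≤ ·) c → ∀ q₀ ∈ c, ∃ ub ∈ {q : (E → ℝ)ᵒᵈ | IsSupSublinear (OrderDual.ofDual q)},
        ∀ q ∈ c, q ≤ ub by
    obtain ⟨m, hpm, hm⟩ := zorn_le_nonempty₀ _ hchains (OrderDual.toDual p) hp
    exact ⟨OrderDual.ofDual m, hm.1, hpm, fun q hq hqm => hm.2 (y := OrderDual.toDual q) hq hqm⟩
  intro c hc hchain q₀ hq₀
  have : Nonempty c := ⟨⟨q₀, hq₀⟩⟩
  let P : c → E → ℝ := fun q => OrderDual.ofDual q.1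
  have hP : ∀ q : c, IsSupSublinear (P q) := fun q => hc q.2
  have hdir : ∀ q r : c, ∃ s : c, P s ≤ P q ∧ P s ≤ P r := by
    intro q r
    rcases hchain.total q.2 r.2 with h | h
    · exact ⟨r, h, le_rfl⟩
    · exact ⟨q, le_rfl, h⟩
  have hbdd : ∀ x, BddBelow (Set.range fun i => P i x) := by
    intro x
    refine ⟨-P ⟨q₀, hq₀⟩ (-x), ?_⟩
    rintro _ ⟨q, rfl⟩
    obtain ⟨s, hs, hs'⟩ := hdir q ⟨q₀, hq₀⟩
    have h := (hP s).neg_le x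
    linarith [hs x, hs' (-x)]
  refine ⟨OrderDual.toDual fun x => ⨅ i, P i x,
    iInf hbdd (fun i => (hP i).mono) ?_ ?_ ?_, fun q hq x => ciInf_le (hbdd x) ⟨q, hq⟩⟩
  · intro i j x y
    obtain ⟨k, hi, hj⟩ := hdir i j
    exact ⟨k, ((hP k).add_le x y).trans (add_le_add (hi x) (hj y))⟩
  · exact fun i c hc x => ⟨i, (hP i).smul_le c hc x⟩
  · intro i j x y
    obtain ⟨k, hi, hj⟩ := hdir i j
    exact ⟨k, ((hP k).sup_le x y).trans (max_le_max (hi x) (hj y))⟩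

/-- A Hahn--Banach theorem for lattice homomorphisms: every `p` dominates a real lattice
homomorphism that agrees with `p` at a given vector. -/
theorem exists_isLatticeHom (hp : IsSupSublinear p) (z : E) :
    ∃ φ : E →ₗ[ℝ] ℝ, IsLatticeHom φ ∧ (∀ x, φ x ≤ p x) ∧ φ z = p z := by
  obtain ⟨p', hp', hle, hz⟩ := hp.exists_le_neg z
  obtain ⟨m, hm, hmp, hmin⟩ := hp'.exists_minimal
  have hneg : ∀ x, m (-x) = -m x := by
    intro x
    obtain ⟨q, hq, hqm, hqx⟩ := hm.exists_le_neg x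
    have h1 := hmin q hq hqm (-x)
    have h2 := hm.neg_le x
    linarith
  let φ : E →ₗ[ℝ] ℝ :=
    { toFun := m
      map_add' := by
        intro x y
        have h1 := hm.add_le x y
        have h2 := hm.add_le (-x) (-y)
        rw [← neg_add, hneg, hneg, hneg] at h2
        linarith
      map_smul' := by
        intro c x
        rw [RingHom.id_apply, smul_eq_mul]
        rcases lt_trichotomy c 0 with hc | rfl | hc
        · rw [← neg_neg (c • x), hneg, ← neg_smul, hm.map_smul (neg_pos.2 hc)]
          ring
        · rw [zero_smul, zero_mul, hm.map_zero]
        · exact hm.map_smul hc x }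
  have hsup : ∀ a b, φ (a ⊔ b) = φ a ⊔ φ b := fun a b =>
    le_antisymm (hm.sup_le a b) (max_le (hm.mono le_sup_left) (hm.mono le_sup_right))
  refine ⟨φ, ⟨hsup, fun a b => ?_⟩, fun x => (hmp x).trans (hle x), ?_⟩
  · rw [← neg_neg (a ⊓ b), neg_inf, map_neg, hsup, map_neg, map_neg]
    exact (neg_sup _ _).trans (by rw [neg_neg, neg_neg])
  · refine le_antisymm ((hmp z).trans (hle z)) ?_
    have h := (hmp (-z)).trans hz
    rw [hneg] at h
    exact neg_le_neg_iff.1 h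

end IsSupSublinear

/-! ### Order units in Archimedean vector lattices -/

theorem IsArchimedean.le_smul (hE : IsArchimedean E) {e y : E} (he : 0 ≤ e) {c : ℝ}
    (h : ∀ d, c < d → y ≤ d • e) : y ≤ c • e := by
  have h0 : (y - c • e) ⊔ 0 = 0 := by
    refine hE _ e le_sup_right he fun n => ?_
    rcases n.eq_zero_or_pos with rfl | hn
    · rwa [zero_smul]
    have hn' : (0 : ℝ) < n := Nat.cast_pos.2 hn
    have h1 : (y - c • e) ⊔ 0 ≤ (n : ℝ)⁻¹ • e := by
      refine sup_le ?_ (smul_nonneg (inv_pos.2 hn').le he)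
      rw [sub_le_iff_le_add, ← add_smul]
      exact h _ (lt_add_of_pos_left c (inv_pos.2 hn'))
    have h2 := smul_le_smul_of_nonneg_left h1 hn'.le
    rwa [smul_smul, mul_inv_cancel₀ hn'.ne', one_smul, Nat.cast_smul_eq_nsmul] at h2
  exact sub_nonpos.1 (sup_eq_right.1 h0)

/-- The gauge `x ↦ inf {c | x ≤ c e}` of an order unit `e`. -/
theorem exists_gauge (hE : IsArchimedean E) {e : E} (he : 0 ≤ e) (hne : e ≠ 0)
    (hunit : ∀ y : E, ∃ c : ℝ, y ≤ c • e) :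
    ∃ p : E → ℝ, IsSupSublinear p ∧ ∀ y c, p y ≤ c ↔ y ≤ c • e := by
  have hmono : ∀ {c d : ℝ}, c ≤ d → c • e ≤ d • e := fun h => smul_le_smul_of_nonneg_right h he
  have hbdd : ∀ y : E, BddBelow {c : ℝ | y ≤ c • e} := by
    intro y
    obtain ⟨d, hd⟩ := hunit (-y)
    refine ⟨-d, fun c hc => ?_⟩
    by_contra hlt
    have h1 : (0 : E) ≤ (c + d) • e := by
      rw [add_smul, ← add_neg_cancel y]
      exact add_le_add hc hd
    have h2 : (c + d) • e ≤ 0 := smul_nonpos_of_nonpos_of_nonneg (by linarith) he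
    rcases smul_eq_zero.1 (le_antisymm h2 h1) with h | h
    · linarith
    · exact hne h
  have key : ∀ y c, sInf {c : ℝ | y ≤ c • e} ≤ c ↔ y ≤ c • e := by
    refine fun y c => ⟨fun h => hE.le_smul he fun d hd => ?_, fun h => csInf_le (hbdd y) h⟩
    obtain ⟨b, hb, hbd⟩ := exists_lt_of_csInf_lt (hunit y) (h.trans_lt hd)
    exact le_trans hb (hmono hbd.le)
  refine ⟨_, ⟨fun x y h => ?_, fun x y => ?_, fun c hc x => ?_, fun x y => ?_⟩, key⟩
  · exact (key _ _).2 (h.trans ((key _ _).1 le_rfl))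
  · rw [key, add_smul]
    exact add_le_add ((key _ _).1 le_rfl) ((key _ _).1 le_rfl)
  · rw [key, mul_smul]
    exact smul_le_smul_of_nonneg_left ((key _ _).1 le_rfl) hc.le
  · rw [key]
    exact sup_le (((key _ _).1 le_rfl).trans (hmono (le_max_left _ _)))
      (((key _ _).1 le_rfl).trans (hmono (le_max_right _ _)))

/-- The lattice homomorphisms `φ` with `φ e = 1` determine the order: this is the part of the
Kakutani--Yosida representation theorem that the function calculus needs. -/
theorem le_smul_of_forall_isLatticeHom (hE : IsArchimedean E) {e : E} (he : 0 ≤ e)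
    (hunit : ∀ y : E, ∃ c : ℝ, y ≤ c • e) {y : E} {c : ℝ}
    (h : ∀ φ : E →ₗ[ℝ] ℝ, IsLatticeHom φ → φ e = 1 → φ y ≤ c) : y ≤ c • e := by
  -- If `e = 0` there is no `φ` with `φ e = 1`, but then `E` is trivial.
  rcases eq_or_ne e 0 with rfl | hne
  · obtain ⟨d, hd⟩ := hunit y
    rwa [smul_zero] at hd ⊢
  obtain ⟨p, hp, hpc⟩ := exists_gauge hE he hne hunit
  obtain ⟨φ, hφ, hφp, hφy⟩ := hp.exists_isLatticeHom y
  rw [← hpc, ← hφy]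
  refine h φ hφ (le_antisymm ((hφp e).trans ((hpc _ _).2 (one_smul ℝ e).ge)) ?_)
  have h1 := (hφp (-e)).trans ((hpc (-e) (-1)).2 (by rw [neg_smul, one_smul]))
  rw [map_neg] at h1
  linarith

end Sublinear

/-! ### Positively homogeneous continuous functions -/

section Homogeneous

variable {n : ℕ}

/-- Evaluation at `t`, as a linear functional on `H n`. -/
def evalAt (t : Fin n → ℝ) : H n →ₗ[ℝ] ℝ where
  toFun f := (f : C(Fin n → ℝ, ℝ)) t
  map_add' _ _ := rfl
  map_smul' _ _ := rfl

theorem isLatticeHom_evalAt (t : Fin n → ℝ) : IsLatticeHom (evalAt t) :=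
  ⟨fun _ _ => rfl, fun _ _ => rfl⟩

theorem evalAt_smul (f : H n) {c : ℝ} (hc : 0 ≤ c) (t : Fin n → ℝ) :
    evalAt (c • t) f = c * evalAt t f :=
  f.2 c hc t

theorem H_le_iff {f g : H n} : f ≤ g ↔ ∀ t, evalAt t f ≤ evalAt t g :=
  Iff.rfl

variable (n) in
/-- The function `t ↦ |t₁| + ⋯ + |tₙ|`, an order unit of `H n`. -/
def sumAbs : H n := ∑ i, |proj i|

theorem evalAt_sumAbs (t : Fin n → ℝ) : evalAt t (sumAbs n) = ∑ i, |t i| := by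
  rw [sumAbs, map_sum]
  exact Finset.sum_congr rfl fun i _ => (isLatticeHom_evalAt t).map_abs _

theorem evalAt_sumAbs_nonneg (t : Fin n → ℝ) : 0 ≤ evalAt t (sumAbs n) := by
  rw [evalAt_sumAbs]
  exact Finset.sum_nonneg fun i _ => abs_nonneg _

theorem abs_le_smul_sumAbs_iff {f : H n} {c : ℝ} :
    |f| ≤ c • sumAbs n ↔ ∀ t, |evalAt t f| ≤ c * evalAt t (sumAbs n) := by
  rw [H_le_iff]
  refine forall_congr' fun t => ?_
  rw [(isLatticeHom_evalAt t).map_abs, map_smul, smul_eq_mul]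

/-- By homogeneity, estimates in `H n` can be checked on the unit sphere of the `ℓ¹` norm. -/
theorem abs_le_smul_sumAbs {f : H n} {c : ℝ}
    (h : ∀ t : Fin n → ℝ, ∑ i, |t i| = 1 → |evalAt t f| ≤ c) : |f| ≤ c • sumAbs n := by
  rw [abs_le_smul_sumAbs_iff]
  intro t
  rw [evalAt_sumAbs]
  set r := ∑ i, |t i| with hr
  have hr0 : 0 ≤ r := Finset.sum_nonneg fun i _ => abs_nonneg _
  rcases hr0.eq_or_lt with h0 | hpos
  · have ht : t = (0 : ℝ) • t := by
      ext i
      have := (Finset.sum_eq_zero_iff_of_nonneg fun i _ => abs_nonneg (t i)).1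
        (hr.symm.trans h0.symm) i (Finset.mem_univ i)
      simpa using this
    rw [ht, evalAt_smul f le_rfl, ← h0]
    simp
  · have ht : t = r • (r⁻¹ • t) := by
      rw [smul_smul, mul_inv_cancel₀ hpos.ne', one_smul]
    have h1 : ∑ i, |(r⁻¹ • t) i| = 1 := by
      simp only [Pi.smul_apply, smul_eq_mul, abs_mul, ← Finset.mul_sum, abs_of_pos (inv_pos.2 hpos)]
      exact inv_mul_cancel₀ hpos.ne'
    rw [ht, evalAt_smul f hr0, abs_mul, abs_of_pos hpos, mul_comm]
    exact mul_le_mul_of_nonneg_right (h _ h1) hr0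

variable (n) in
theorem isCompact_sphere : IsCompact {t : Fin n → ℝ | ∑ i, |t i| = 1} := by
  refine Metric.isCompact_of_isClosed_isBounded ?_ ?_
  · exact isClosed_eq (by fun_prop) continuous_const
  · refine Bornology.IsBounded.subset (Metric.isBounded_closedBall (x := (0 : Fin n → ℝ)) (r := 1))
      fun t ht => ?_
    rw [mem_closedBall_zero_iff, pi_norm_le_iff_of_nonneg zero_le_one]
    intro i
    rw [Real.norm_eq_abs, ← (ht : ∑ i, |t i| = 1)]
    exact Finset.single_le_sum (f := fun i => |t i|) (fun i _ => abs_nonneg _) (Finset.mem_univ i)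

theorem exists_abs_le_smul_sumAbs (f : H n) : ∃ c : ℝ, 0 ≤ c ∧ |f| ≤ c • sumAbs n := by
  obtain ⟨c, hc⟩ := (isCompact_sphere n).exists_bound_of_continuousOn f.1.continuous.continuousOn
  exact ⟨max c 0, le_max_right _ _, abs_le_smul_sumAbs fun t ht => (hc t ht).trans (le_max_left _ _)⟩

/-- Stone--Weierstrass: a vector sublattice of `H n` that contains the coordinate projections is
dense. On the `ℓ¹` sphere it contains the constants, because it contains `sumAbs n`. -/
theorem exists_abs_sub_le_smul_sumAbs {W : Submodule ℝ (H n)} (hsup : SupClosed (W : Set (H n)))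
    (hinf : InfClosed (W : Set (H n))) (hproj : ∀ i, proj i ∈ W) (f : H n) {ε : ℝ} (hε : 0 < ε) :
    ∃ g ∈ W, |f - g| ≤ ε • sumAbs n := by
  have hunit : sumAbs n ∈ W :=
    W.sum_mem fun i _ => hsup (hproj i) (W.neg_mem (hproj i))
  let S : Set (Fin n → ℝ) := {t | ∑ i, |t i| = 1}
  have : CompactSpace S := isCompact_iff_compactSpace.1 (isCompact_sphere n)
  let res : H n → C(S, ℝ) := fun g => g.1.restrict S
  have hdense := ContinuousMap.sublattice_closure_eq_top (res '' W) ⟨_, 0, W.zero_mem, rfl⟩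
    (by
      rintro _ ⟨g, hg, rfl⟩ _ ⟨g', hg', rfl⟩
      exact ⟨g ⊓ g', hinf hg hg', rfl⟩)
    (by
      rintro _ ⟨g, hg, rfl⟩ _ ⟨g', hg', rfl⟩
      exact ⟨g ⊔ g', hsup hg hg', rfl⟩)
    (by
      intro v s t
      by_cases hst : s = t
      · subst hst
        refine ⟨_, ⟨v s • sumAbs n, W.smul_mem _ hunit, rfl⟩, ?_, ?_⟩ <;>
        · change evalAt s.1 (v s • sumAbs n) = v s
          rw [map_smul, evalAt_sumAbs, s.2, smul_eq_mul, mul_one]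
      · obtain ⟨i, hi⟩ : ∃ i, s.1 i ≠ t.1 i := by
          by_contra! h
          exact hst (Subtype.ext (funext h))
        have hd : s.1 i - t.1 i ≠ 0 := sub_ne_zero.2 hi
        -- the affine function of the `i`-th coordinate with the prescribed values
        let a : ℝ := (v s - v t) / (s.1 i - t.1 i)
        have heval : ∀ r : S, evalAt r.1 (a • proj i + (v s - a * s.1 i) • sumAbs n)
            = a * r.1 i + (v s - a * s.1 i) := by
          intro r
          rw [map_add, map_smul, map_smul, evalAt_sumAbs, r.2, smul_eq_mul, smul_eq_mul, mul_one]
          rfl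
        refine ⟨_, ⟨_, W.add_mem (W.smul_mem a (hproj i))
          (W.smul_mem (v s - a * s.1 i) hunit), rfl⟩, (heval s).trans (by ring),
          (heval t).trans ?_⟩
        simp only [a]
        field_simp
        ring)
  have hf : res f ∈ closure (res '' W) := by rw [hdense]; trivial
  obtain ⟨_, ⟨g, hg, rfl⟩, hfg⟩ := Metric.mem_closure_iff.1 hf ε hε
  refine ⟨g, hg, abs_le_smul_sumAbs fun t ht => ?_⟩
  rw [map_sub, ← Real.dist_eq]
  exact (ContinuousMap.dist_apply_le_dist (f := res f) (g := res g) ⟨t, ht⟩).trans hfg.le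

/-- Uniform completeness of `H n` with respect to `sumAbs n`, for geometric series. -/
theorem exists_abs_sub_sum_le (g : ℕ → H n) (hg : ∀ k, |g k| ≤ ((1 / 2 : ℝ) ^ k) • sumAbs n) :
    ∃ f : H n, ∀ N, |f - ∑ k ∈ Finset.range N, g k| ≤ (2 * (1 / 2 : ℝ) ^ N) • sumAbs n := by
  have hg' : ∀ k t, ‖evalAt t (g k)‖ ≤ (1 / 2 : ℝ) ^ k * evalAt t (sumAbs n) :=
    fun k => abs_le_smul_sumAbs_iff.1 (hg k)
  have hsummable : ∀ t, Summable fun k => evalAt t (g k) := fun t =>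
    (summable_geometric_two.mul_right _).of_norm_bounded fun k => hg' k t
  have hcont : Continuous fun t => ∑' k, evalAt t (g k) := by
    rw [continuous_iff_continuousAt]
    intro t₀
    have hopen : IsOpen {t : Fin n → ℝ | evalAt t (sumAbs n) < evalAt t₀ (sumAbs n) + 1} :=
      isOpen_lt (sumAbs n).1.continuous continuous_const
    refine ContinuousOn.continuousAt ?_ (hopen.mem_nhds (Set.mem_ofPred.2 (lt_add_one _)))
    refine continuousOn_tsum (fun k => (g k).1.continuous.continuousOn)
      (summable_geometric_two.mul_right (evalAt t₀ (sumAbs n) + 1)) fun k t ht => ?_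
    exact (hg' k t).trans (mul_le_mul_of_nonneg_left (le_of_lt ht) (by positivity))
  let f : H n := ⟨⟨_, hcont⟩, fun c hc t => by
    change ∑' k, evalAt (c • t) (g k) = c * ∑' k, evalAt t (g k)
    rw [← tsum_mul_left]
    exact tsum_congr fun k => evalAt_smul _ hc t⟩
  refine ⟨f, fun N => abs_le_smul_sumAbs_iff.2 fun t => ?_⟩
  have h1 : evalAt t (f - ∑ k ∈ Finset.range N, g k) = ∑' k, evalAt t (g (k + N)) := by
    rw [map_sub, map_sum, sub_eq_iff_eq_add']
    exact ((hsummable t).sum_add_tsum_nat_add N).symm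
  rw [h1]
  refine tsum_of_norm_bounded (g := fun k => (1 / 2 : ℝ) ^ (k + N) * evalAt t (sumAbs n)) ?_
    fun k => hg' (k + N) t
  simpa only [pow_add] using
    (hasSum_geometric_two.mul_right ((1 / 2 : ℝ) ^ N)).mul_right (evalAt t (sumAbs n))

end Homogeneous

/-! ### Closed sublattices -/

section ClosedSublattice

variable {E : Type*} [AddCommGroup E] [Lattice E] [Module ℝ E] [TopologicalSpace E] (S : Set E)

theorem subset_closedSublattice : S ⊆ closedSublattice S := fun _ hx =>
  (Submodule.mem_sInf).2 fun _ hY => hY.2.2.2 hx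

theorem supClosed_closedSublattice : SupClosed (closedSublattice S : Set E) :=
  fun _ ha _ hb => (Submodule.mem_sInf).2 fun Y hY =>
    hY.1 ((Submodule.mem_sInf).1 ha Y hY) ((Submodule.mem_sInf).1 hb Y hY)

theorem infClosed_closedSublattice : InfClosed (closedSublattice S : Set E) :=
  fun _ ha _ hb => (Submodule.mem_sInf).2 fun Y hY =>
    hY.2.1 ((Submodule.mem_sInf).1 ha Y hY) ((Submodule.mem_sInf).1 hb Y hY)

theorem isClosed_closedSublattice : IsClosed (closedSublattice S : Set E) := by
  rw [closedSublattice, Submodule.coe_sInf]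
  exact isClosed_biInter fun Y hY => hY.2.2.1

end ClosedSublattice

section Calculus

variable {X : Type*} [AddCommGroup X] [Lattice X] [IsOrderedAddMonoid X] [Module ℝ X]
  [IsOrderedModule ℝ X]

/-! ### The order ideal generated by a positive element -/

instance isOrderedAddMonoid_orderIdeal (e : X) : IsOrderedAddMonoid (orderIdeal e) where
  add_le_add_left _ _ h c := add_le_add_left (α := X) h c

instance isOrderedModule_orderIdeal (e : X) : IsOrderedModule ℝ (orderIdeal e) where
  smul_le_smul_of_nonneg_left _ hc _ _ h := smul_le_smul_of_nonneg_left (β := X) h hc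
  smul_le_smul_of_nonneg_right _ ha _ _ h := smul_le_smul_of_nonneg_right (β := X) h ha

theorem IsArchimedean.orderIdeal (hX : IsArchimedean X) (e : X) :
    IsArchimedean (orderIdeal e) := fun x y hx hy h =>
  Subtype.ext (hX x y hx hy fun n => h n)

theorem norm_orderIdeal_le {e : X} {y : orderIdeal e} {c : ℝ} (hc : 0 ≤ c)
    (h : |(y : X)| ≤ c • e) : ‖y‖ ≤ c :=
  orderNorm_le hc h

theorem IsArchimedean.abs_le_norm_smul (hX : IsArchimedean X) {e : X} (he : 0 ≤ e)
    (y : VectorLattice.orderIdeal e) : |(y : X)| ≤ ‖y‖ • e := by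
  refine hX.le_smul he fun d hd => ?_
  obtain ⟨c, ⟨-, hc⟩, hcd⟩ := exists_lt_of_csInf_lt y.2 hd
  exact hc.trans (smul_le_smul_of_nonneg_right hcd.le he)

theorem IsArchimedean.t0Space_orderIdeal (hX : IsArchimedean X) {e : X} (he : 0 ≤ e) :
    T0Space (VectorLattice.orderIdeal e) := by
  refine ⟨fun y z hyz => ?_⟩
  have h0 : ‖y - z‖ = 0 := by
    rw [← dist_eq_norm]
    exact Metric.inseparable_iff.1 hyz
  have h1 := hX.abs_le_norm_smul he (y - z)
  rw [h0, zero_smul] at h1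
  have h2 : ((y - z : VectorLattice.orderIdeal e) : X) = 0 :=
    le_antisymm ((le_abs_self _).trans h1) (neg_nonpos.1 ((neg_le_abs _).trans h1))
  exact sub_eq_zero.1 (Subtype.ext h2)

/-! ### Uniqueness of the calculus and compositions -/

theorem IsCalculusAt.unique (hX : IsArchimedean X) {n : ℕ} {x : Fin n → X} {Φ Ψ : H n →ₗ[ℝ] X}
    (hΦ : IsCalculusAt x Φ) (hΨ : IsCalculusAt x Ψ) : Φ = Ψ := by
  let W : Submodule ℝ (H n) := LinearMap.eqLocus Φ Ψ
  have hsup : SupClosed (W : Set (H n)) := fun a ha b hb => by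
    change Φ (a ⊔ b) = Ψ (a ⊔ b)
    rw [hΦ.isLatticeHom.map_sup, hΨ.isLatticeHom.map_sup, show Φ a = Ψ a from ha,
      show Φ b = Ψ b from hb]
  have hinf : InfClosed (W : Set (H n)) := fun a ha b hb => by
    change Φ (a ⊓ b) = Ψ (a ⊓ b)
    rw [hΦ.isLatticeHom.map_inf, hΨ.isLatticeHom.map_inf, show Φ a = Ψ a from ha,
      show Φ b = Ψ b from hb]
  have hproj : ∀ i, proj i ∈ W := fun i => (hΦ.map_proj i).trans (hΨ.map_proj i).symm
  have hunit : Φ (sumAbs n) = Ψ (sumAbs n) :=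
    W.sum_mem fun i _ => hsup (hproj i) (W.neg_mem (hproj i))
  have hpos : 0 ≤ Φ (sumAbs n) := by
    rw [← map_zero Φ]
    exact hΦ.isLatticeHom.monotone (H_le_iff.2 evalAt_sumAbs_nonneg)
  ext f
  have h0 : |Φ f - Ψ f| ≤ (0 : ℝ) • Φ (sumAbs n) := by
    refine hX.le_smul hpos fun d hd => ?_
    obtain ⟨g, hg, hfg⟩ := exists_abs_sub_le_smul_sumAbs hsup hinf hproj f (half_pos hd)
    have h1 : |Φ (f - g)| ≤ (d / 2) • Φ (sumAbs n) := by
      rw [← hΦ.isLatticeHom.map_abs, ← map_smul]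
      exact hΦ.isLatticeHom.monotone hfg
    have h2 : |Ψ (f - g)| ≤ (d / 2) • Φ (sumAbs n) := by
      rw [← hΨ.isLatticeHom.map_abs, hunit, ← map_smul]
      exact hΨ.isLatticeHom.monotone hfg
    have h3 : Φ f - Ψ f = Φ (f - g) + -Ψ (f - g) := by
      rw [map_sub, map_sub, show Φ g = Ψ g from hg]
      abel
    rw [h3, ← add_halves d, add_smul]
    refine (abs_add_le _ _).trans (add_le_add h1 ?_)
    rwa [abs_neg]
  rw [zero_smul] at h0
  exact sub_eq_zero.1
    (le_antisymm ((le_abs_self _).trans h0) (neg_nonpos.1 ((neg_le_abs _).trans h0)))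

/-- Composition with `f₁ × ⋯ × fₘ`, as a linear map. -/
def compLinearMap {m n : ℕ} (f : Fin m → H n) : H m →ₗ[ℝ] H n where
  toFun g := comp g f
  map_add' _ _ := rfl
  map_smul' _ _ := rfl

theorem IsCalculusAt.comp_compLinearMap {m n : ℕ} {x : Fin n → X} {Φ : H n →ₗ[ℝ] X}
    (hΦ : IsCalculusAt x Φ) (f : Fin m → H n) :
    IsCalculusAt (fun i => Φ (f i)) (Φ ∘ₗ compLinearMap f) where
  isLatticeHom :=
    ⟨fun a b => hΦ.isLatticeHom.map_sup (comp a f) (comp b f),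
      fun a b => hΦ.isLatticeHom.map_inf (comp a f) (comp b f)⟩
  map_proj _ := rfl

/-! ### Completeness yields a calculus -/

/-- The value `Φ f` is the unique `y` with `φ y = f (φ x₁, …, φ xₙ)` for all real lattice
homomorphisms `φ` on the order ideal with `φ e = 1`. The functions `f` for which such a `y` exists
in the closed sublattice generated by `x` form a sublattice, which is uniformly closed by
completeness. -/
theorem exists_isCalculusAt (hX : IsArchimedean X) {n : ℕ} {x : Fin n → X} {e : X} (he : 0 ≤ e)
    (hxe : ∀ i, |x i| ≤ e)
    (hcomplete : IsComplete (closedSublattice ((fun y : orderIdeal e => (y : X)) ⁻¹' Set.range x) :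
      Set (orderIdeal e))) :
    ∃ Φ : H n →ₗ[ℝ] X, IsCalculusAt x Φ := by
  set L := closedSublattice ((fun y : orderIdeal e => (y : X)) ⁻¹' Set.range x)
  let u : orderIdeal e := ⟨e, 1, zero_le_one, by rw [abs_of_nonneg he, one_smul]⟩
  let ξ : Fin n → orderIdeal e := fun i =>
    ⟨x i, 1, zero_le_one, (hxe i).trans (one_smul ℝ e).ge⟩
  have hξL : ∀ i, ξ i ∈ L := fun i => subset_closedSublattice _ ⟨i, rfl⟩
  let A : Set (orderIdeal e →ₗ[ℝ] ℝ) := {φ | IsLatticeHom φ ∧ φ u = 1}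
  have hsep : ∀ (y : orderIdeal e) (c : ℝ), (∀ φ ∈ A, φ y ≤ c) → y ≤ c • u := fun y c h =>
    le_smul_of_forall_isLatticeHom (hX.orderIdeal e) (e := u) he
      (fun z => by
        obtain ⟨d, -, hd⟩ := z.2
        exact ⟨d, (le_abs_self (z : X)).trans hd⟩)
      fun φ h1 h2 => h φ ⟨h1, h2⟩
  have hext : ∀ y z : orderIdeal e, (∀ φ ∈ A, φ y = φ z) → y = z := by
    have hle : ∀ y z : orderIdeal e, (∀ φ ∈ A, φ y = φ z) → y ≤ z := fun y z h => by
      have h1 := hsep (y - z) 0 fun φ hφ => by rw [map_sub, h φ hφ, sub_self]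
      rw [zero_smul] at h1
      exact sub_nonpos.1 h1
    exact fun y z h => le_antisymm (hle y z h) (hle z y fun φ hφ => (h φ hφ).symm)
  have hnorm : ∀ (y : orderIdeal e) (c : ℝ), 0 ≤ c → (∀ φ ∈ A, |φ y| ≤ c) → ‖y‖ ≤ c := by
    intro y c hc h
    refine norm_orderIdeal_le hc (abs_le'.2 ⟨?_, ?_⟩)
    · exact hsep y c fun φ hφ => (le_abs_self _).trans (h φ hφ)
    · refine hsep (-y) c fun φ hφ => ?_
      rw [map_neg]
      exact (neg_le_abs _).trans (h φ hφ)
  have hbound : ∀ φ ∈ A, ∀ y, |φ y| ≤ ‖y‖ := by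
    intro φ hφ y
    have h1 : |y| ≤ ‖y‖ • u := hX.abs_le_norm_smul he y
    have h2 := hφ.1.monotone h1
    rwa [hφ.1.map_abs, map_smul, hφ.2, smul_eq_mul, mul_one] at h2
  -- the point of `ℝⁿ` at which `φ` evaluates
  let pt : (orderIdeal e →ₗ[ℝ] ℝ) → Fin n → ℝ := fun φ i => φ (ξ i)
  let W : Submodule ℝ (H n) :=
    { carrier := {f | ∃ y ∈ L, ∀ φ ∈ A, φ y = evalAt (pt φ) f}
      zero_mem' := ⟨0, L.zero_mem, fun φ _ => by rw [map_zero, map_zero]⟩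
      add_mem' := by
        rintro f g ⟨y, hy, hyf⟩ ⟨z, hz, hzg⟩
        exact ⟨y + z, L.add_mem hy hz, fun φ hφ => by rw [map_add, map_add, hyf φ hφ, hzg φ hφ]⟩
      smul_mem' := by
        rintro c f ⟨y, hy, hyf⟩
        exact ⟨c • y, L.smul_mem c hy, fun φ hφ => by rw [map_smul, map_smul, hyf φ hφ]⟩ }
  have hWsup : SupClosed (W : Set (H n)) := by
    rintro f ⟨y, hy, hyf⟩ g ⟨z, hz, hzg⟩
    refine ⟨y ⊔ z, supClosed_closedSublattice _ hy hz, fun φ hφ => ?_⟩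
    rw [hφ.1.map_sup, (isLatticeHom_evalAt _).map_sup, hyf φ hφ, hzg φ hφ]
  have hWinf : InfClosed (W : Set (H n)) := by
    rintro f ⟨y, hy, hyf⟩ g ⟨z, hz, hzg⟩
    refine ⟨y ⊓ z, infClosed_closedSublattice _ hy hz, fun φ hφ => ?_⟩
    rw [hφ.1.map_inf, (isLatticeHom_evalAt _).map_inf, hyf φ hφ, hzg φ hφ]
  have hWproj : ∀ i, proj i ∈ W := fun i => ⟨ξ i, hξL i, fun φ _ => rfl⟩
  have hpt : ∀ φ ∈ A, evalAt (pt φ) (sumAbs n) ≤ n := by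
    intro φ hφ
    rw [evalAt_sumAbs]
    calc ∑ i, |φ (ξ i)| ≤ ∑ _i : Fin n, (1 : ℝ) := Finset.sum_le_sum fun i _ =>
          (hbound φ hφ (ξ i)).trans
            (norm_orderIdeal_le zero_le_one ((hxe i).trans (one_smul ℝ e).ge))
      _ = n := by simp
  have hrep : ∀ f : H n, ∃ y : orderIdeal e, ∀ φ ∈ A, φ y = evalAt (pt φ) f := by
    intro f
    have hε : ∀ k : ℕ, (0 : ℝ) < 1 / ((k : ℝ) + 1) := fun k => Nat.one_div_pos_of_nat
    choose g hgW hfg using fun k : ℕ =>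
      exists_abs_sub_le_smul_sumAbs hWsup hWinf hWproj f (hε k)
    choose y hyL hy using hgW
    have happrox : ∀ k, ∀ φ ∈ A,
        |φ (y k) - evalAt (pt φ) f| ≤ 1 / ((k : ℝ) + 1) * n := by
      intro k φ hφ
      rw [hy k φ hφ, abs_sub_comm, ← map_sub]
      exact (abs_le_smul_sumAbs_iff.1 (hfg k) (pt φ)).trans
        (mul_le_mul_of_nonneg_left (hpt φ hφ) (hε k).le)
    have hlim : Tendsto (fun k : ℕ => 1 / ((k : ℝ) + 1) * n) atTop (𝓝 0) := by
      simpa using tendsto_one_div_add_atTop_nhds_zero_nat.mul_const (n : ℝ)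
    have hcauchy : CauchySeq y := by
      refine cauchySeq_of_le_tendsto_0 (fun k : ℕ => 2 * (1 / ((k : ℝ) + 1) * n)) ?_
        (by simpa using hlim.const_mul 2)
      intro k l N hk hl
      rw [dist_eq_norm]
      have hdecr : ∀ k, N ≤ k → 1 / ((k : ℝ) + 1) * n ≤ 1 / ((N : ℝ) + 1) * n := fun k h =>
        mul_le_mul_of_nonneg_right (Nat.one_div_le_one_div h) (Nat.cast_nonneg n)
      refine hnorm _ _ (mul_nonneg zero_le_two (mul_nonneg (hε N).le (Nat.cast_nonneg n)))
        fun φ hφ => ?_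
      rw [map_sub]
      have h1 := abs_sub_le (φ (y k)) (evalAt (pt φ) f) (φ (y l))
      rw [abs_sub_comm (evalAt (pt φ) f)] at h1
      linarith [happrox k φ hφ, happrox l φ hφ, hdecr k hk, hdecr l hl]
    obtain ⟨z, -, hz⟩ := cauchySeq_tendsto_of_isComplete hcomplete hyL hcauchy
    refine ⟨z, fun φ hφ => ?_⟩
    have h1 : Tendsto (fun k => φ (y k)) atTop (𝓝 (φ z)) := by
      rw [tendsto_iff_dist_tendsto_zero]
      refine squeeze_zero (fun _ => dist_nonneg) (fun k => ?_)
        (tendsto_iff_norm_sub_tendsto_zero.1 hz)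
      rw [Real.dist_eq, ← map_sub]
      exact hbound φ hφ _
    refine tendsto_nhds_unique h1 ?_
    rw [tendsto_iff_dist_tendsto_zero]
    exact squeeze_zero (fun _ => dist_nonneg) (fun k => happrox k φ hφ) hlim
  choose Y hY using hrep
  let T : H n →ₗ[ℝ] orderIdeal e :=
    { toFun := Y
      map_add' := fun f g => hext _ _ fun φ hφ => by
        rw [map_add, hY _ φ hφ, hY _ φ hφ, hY _ φ hφ, map_add]
      map_smul' := fun c f => hext _ _ fun φ hφ => by
        rw [RingHom.id_apply, map_smul, hY _ φ hφ, hY _ φ hφ, map_smul] }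
  have hTsup : ∀ f g, T (f ⊔ g) = T f ⊔ T g := fun f g => hext _ _ fun φ hφ => by
    change φ (Y (f ⊔ g)) = φ (Y f ⊔ Y g)
    rw [hφ.1.map_sup, hY _ φ hφ, hY _ φ hφ, hY _ φ hφ, (isLatticeHom_evalAt _).map_sup]
  have hTinf : ∀ f g, T (f ⊓ g) = T f ⊓ T g := fun f g => hext _ _ fun φ hφ => by
    change φ (Y (f ⊓ g)) = φ (Y f ⊓ Y g)
    rw [hφ.1.map_inf, hY _ φ hφ, hY _ φ hφ, hY _ φ hφ, (isLatticeHom_evalAt _).map_inf]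
  have hTproj : ∀ i, T (proj i) = ξ i := fun i => hext _ _ fun φ hφ => hY _ φ hφ
  exact ⟨(orderIdeal e).subtype ∘ₗ T,
    ⟨fun f g => congrArg Subtype.val (hTsup f g), fun f g => congrArg Subtype.val (hTinf f g)⟩,
    fun i => congrArg Subtype.val (hTproj i)⟩

/-! ### A calculus yields completeness -/

/-- Truncation by multiples of `sumAbs n` shows that elements in the range of a lattice homomorphism
on `H n` have preimages that are no larger. -/
theorem IsLatticeHom.exists_abs_le_preimage {n : ℕ} {Φ : H n →ₗ[ℝ] X} (hΦ : IsLatticeHom Φ)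
    (f : H n) {c : ℝ} (hc : 0 ≤ c) (h : |Φ f| ≤ c • Φ (sumAbs n)) :
    ∃ g : H n, Φ g = Φ f ∧ |g| ≤ c • sumAbs n := by
  refine ⟨(f ⊓ c • sumAbs n) ⊔ -(c • sumAbs n), ?_, abs_le_smul_sumAbs_iff.2 fun t => ?_⟩
  · rw [hΦ.map_sup, hΦ.map_inf, map_neg, map_smul, inf_eq_left.2 ((le_abs_self _).trans h),
      sup_eq_left.2 (neg_le.1 ((neg_le_abs _).trans h))]
  · have h0 := mul_nonneg hc (evalAt_sumAbs_nonneg t)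
    rw [(isLatticeHom_evalAt t).map_sup, (isLatticeHom_evalAt t).map_inf, map_neg, map_smul,
      smul_eq_mul, abs_le]
    exact ⟨le_sup_right, sup_le inf_le_right (by linarith)⟩

theorem IsCalculusAt.exists_isComplete_closedSublattice (hX : IsArchimedean X) {n : ℕ}
    {x : Fin n → X} {Φ : H n →ₗ[ℝ] X} (hΦ : IsCalculusAt x Φ) :
    ∃ e : X, 0 ≤ e ∧ (∀ i, |x i| ≤ e) ∧
      IsComplete (closedSublattice ((fun y : orderIdeal e => (y : X)) ⁻¹' Set.range x) :
        Set (orderIdeal e)) := by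
  have hlat := hΦ.isLatticeHom
  -- `e` is kept opaque, because the type `orderIdeal e` depends on it.
  obtain ⟨e, hedef⟩ : ∃ e, e = Φ (sumAbs n) := ⟨_, rfl⟩
  have hesum : e = ∑ i, |x i| := by
    rw [hedef, sumAbs, map_sum]
    exact Finset.sum_congr rfl fun i _ => by rw [hlat.map_abs, hΦ.map_proj]
  have he : 0 ≤ e := hesum ▸ Finset.sum_nonneg fun i _ => abs_nonneg _
  have hmem : ∀ {f : H n} {c : ℝ}, |f| ≤ c • sumAbs n → |Φ f| ≤ c • e := by
    intro f c h
    rw [hedef, ← hlat.map_abs, ← map_smul]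
    exact hlat.monotone h
  refine ⟨e, he, fun i => hesum ▸ Finset.single_le_sum (f := fun i => |x i|)
    (fun i _ => abs_nonneg _) (Finset.mem_univ i), ?_⟩
  let R : Submodule ℝ (orderIdeal e) := (LinearMap.range Φ).comap (orderIdeal e).subtype
  have hRsup : SupClosed (R : Set (orderIdeal e)) := by
    rintro y ⟨f, hf⟩ z ⟨g, hg⟩
    exact ⟨f ⊔ g, (hlat.map_sup f g).trans (by rw [hf, hg]; rfl)⟩
  have hRinf : InfClosed (R : Set (orderIdeal e)) := by
    rintro y ⟨f, hf⟩ z ⟨g, hg⟩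
    exact ⟨f ⊓ g, (hlat.map_inf f g).trans (by rw [hf, hg]; rfl)⟩
  have hRcomplete : IsComplete (R : Set (orderIdeal e)) := by
    rw [← completeSpace_coe_iff_isComplete]
    refine Metric.complete_of_convergent_controlled_sequences (fun k => (1 / 2 : ℝ) ^ k)
      (fun k => by positivity) fun y hy => ?_
    -- The differences of the lifts `a k` need not be small, so each difference is replaced by a small
    -- lift `g k` of `y (k + 1) - y k`, and these are summed up.
    choose a ha using fun k => (y k).2
    have hstep : ∀ k, ∃ g : H n, Φ g = Φ (a (k + 1) - a k) ∧
        |g| ≤ ((1 / 2 : ℝ) ^ k) • sumAbs n := by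
      intro k
      refine hlat.exists_abs_le_preimage _ (by positivity) ?_
      have h1 : Φ (a (k + 1) - a k) = (((y (k + 1) : orderIdeal e) - (y k : orderIdeal e) :
          orderIdeal e) : X) := by
        rw [map_sub, ha, ha]
        rfl
      have h2 := hy k (k + 1) k k.le_succ le_rfl
      rw [Subtype.dist_eq, dist_eq_norm] at h2
      rw [h1, ← hedef]
      exact (hX.abs_le_norm_smul he _).trans (smul_le_smul_of_nonneg_right h2.le he)
    choose g hg hgle using hstep
    obtain ⟨f, hf⟩ := exists_abs_sub_sum_le g hgle
    have hsum : ∀ N, Φ (∑ k ∈ Finset.range N, g k) = Φ (a N) - Φ (a 0) := by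
      intro N
      rw [map_sum, ← Finset.sum_range_sub (fun k => Φ (a k)) N]
      exact Finset.sum_congr rfl fun k _ => by rw [hg, map_sub]
    obtain ⟨c, hc, hcle⟩ := exists_abs_le_smul_sumAbs (a 0 + f)
    let z : R := ⟨⟨Φ (a 0 + f), c, hc, hmem hcle⟩, _, rfl⟩
    refine ⟨z, ?_⟩
    rw [tendsto_iff_dist_tendsto_zero]
    have hlim : Tendsto (fun N : ℕ => 2 * (1 / 2 : ℝ) ^ N) atTop (𝓝 0) := by
      simpa using (tendsto_pow_atTop_nhds_zero_of_lt_one (r := (1 / 2 : ℝ)) (by norm_num)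
        (by norm_num)).const_mul 2
    refine squeeze_zero (fun _ => dist_nonneg) (fun N => ?_) hlim
    rw [dist_comm, Subtype.dist_eq, dist_eq_norm]
    refine norm_orderIdeal_le (by positivity) ?_
    have h1 : (((z : orderIdeal e) - (y N : orderIdeal e) : orderIdeal e) : X)
        = Φ (f - ∑ k ∈ Finset.range N, g k) := by
      rw [map_sub, hsum, ha N]
      change Φ (a 0 + f) - _ = _
      rw [map_add]
      change _ - ((y N : orderIdeal e) : X) = Φ f - (((y N : orderIdeal e) : X) - Φ (a 0))
      abel
    rw [h1]
    exact hmem (hf N)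
  have : T0Space (orderIdeal e) := hX.t0Space_orderIdeal he
  have hle : closedSublattice ((fun y : orderIdeal e => (y : X)) ⁻¹' Set.range x) ≤ R := by
    refine sInf_le ⟨hRsup, hRinf, hRcomplete.isClosed, ?_⟩
    rintro y ⟨i, hi⟩
    exact ⟨proj i, (hΦ.map_proj i).trans hi⟩
  intro l hl hlS
  obtain ⟨y, -, hy⟩ := hRcomplete l hl (hlS.trans (principal_mono.2 hle))
  have := hl.1
  exact ⟨y, (isClosed_closedSublattice _).mem_of_tendsto (f := id) hy
    (le_principal_iff.1 hlS), hy⟩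

end Calculus

end VectorLattice

theorem theorem1p3 (X : Type*) [AddCommGroup X] [Lattice X] [IsOrderedAddMonoid X]
    [Module ℝ X] [IsOrderedModule ℝ X] (hX : VectorLattice.IsArchimedean X) :
    (VectorLattice.AdmitsCalculus X ↔ VectorLattice.FinitelyUniformlyComplete X) ∧
    (VectorLattice.FinitelyUniformlyComplete X →
      (∀ (n : ℕ) (x : Fin n → X),
        ∃! Φ : VectorLattice.H n →ₗ[ℝ] X, VectorLattice.IsCalculusAt x Φ) ∧
      (∀ Φ : (n : ℕ) → (Fin n → X) → (VectorLattice.H n →ₗ[ℝ] X),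
        VectorLattice.IsCalculus Φ →
        ∀ (m n : ℕ) (x : Fin n → X) (f : Fin m → VectorLattice.H n) (g : VectorLattice.H m),
          Φ m (fun i => Φ n x (f i)) g = Φ n x (VectorLattice.comp g f))) := by
  have hexists : VectorLattice.FinitelyUniformlyComplete X → VectorLattice.AdmitsCalculus X := by
    intro h n x
    obtain ⟨e, he, hxe, hcomplete⟩ := h n x
    exact VectorLattice.exists_isCalculusAt hX he hxe hcomplete
  refine ⟨⟨fun h n x => ?_, hexists⟩, fun h => ⟨fun n x => ?_, fun Φ hΦ m n x f g => ?_⟩⟩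
  · obtain ⟨Φ, hΦ⟩ := h n x
    exact hΦ.exists_isComplete_closedSublattice hX
  · obtain ⟨Φ, hΦ⟩ := hexists h n x
    exact ⟨Φ, hΦ, fun Ψ hΨ => hΨ.unique hX hΦ⟩
  · exact LinearMap.congr_fun
      ((hΦ m _).unique hX ((hΦ n x).comp_compLinearMap f)) g
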